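/- For tuples $\boldsymbol\alpha=(\alpha_1,\dots,\alpha_r)$ and $\boldsymbol\beta=(\beta_1,\dots,\beta_s)$ of rational numbers, none of which is an integer $\le 0$, put $$\mathcal F_{\boldsymbol\alpha,\boldsymbol\beta}(x)=\sum_{n\ge 0}\frac{(\alpha_1)_n\cdots(\alpha_r)_n}{(\beta_1)_n\cdots(\beta_s)_n}\,x^n\in\mathbb Q[[x]],$$ where $(a)_n=a(a+1)\cdots(a+n-1)$ and $(a)_0=1$. For tuples $\mathbf e=(e_1,\dots,e_u)$ and $\mathbf f=(f_1,\dots,f_v)$ of positive integers put $$F_{\mathbf e,\mathbf f}(x)=\sum_{n\ge 0}\frac{(e_1n)!\cdots(e_un)!}{(f_1n)!\cdots(f_vn)!}\,x^n.$$ A series $F\in\mathbb Q[[x]]$ is called globally bounded if it has a non-zero radius of convergence and $F(Cx)\in\mathbb Z[[x]]$ for some $C\in\mathbb Q\setminus\{0\}$. It is called factorial if $F(Cx)=F_{\mathbf e,\mathbf f}(x)$ for some $C\in\mathbb Q\setminus\{0\}$ and some tuples $\mathbf e,\mathbf f$ of positive integers. For a prime $p$ let $\mathbb Z_{(p)}$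 be the ring of rational numbers whose denominator is not divisible by $p$. A series $\sum_{n\ge0}a_nx^n\in\mathbb Q[[x]]$ (with $a_n:=0$ for $n<0$) satisfies Gauss congruences for $p$ if $a_{np}-a_n\in np\,\mathbb Z_{(p)}$ for all integers $n$; it has the Gauss property if it satisfies Gauss congruences for all but finitely many primes $p$. Theorem. Let $\boldsymbol\alpha,\boldsymbol\beta$ be tuples of elements of $\mathbb Q\setminus\mathbb Z_{\le 0}$ such that $\mathcal F_{\boldsymbol\alpha,\boldsymbol\beta}$ is globally bounded. Then $\mathcal F_{\boldsymbol\alpha,\boldsymbol\beta}$ has the Gauss property if and only if it is factorial. Furthermore, in the latter case, if $\mathcal F_{\boldsymbol\alpha,\boldsymbol\beta}(Cx)=F_{\mathbf e,\mathbf f}(x)$ for some non-zero $C\in\mathbb Q$ and some tuples $\mathbf e,\mathbf f$ of positive integers, then $F_{\mathbf e,\mathbf f}$ satisfies Gauss congruences for all prime numbers $p$. -/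

import Mathlib

open scoped PowerSeries

/-- The ring `ℤ_(p)`, as a set: the rational numbers whose (reduced) denominator is not divisible
by `p`. -/
def localizedInt (p : ℕ) : Set ℚ := {r : ℚ | ¬ p ∣ r.den}

/-- The sequence `a : ℤ → ℚ` satisfies Gauss congruences for `p`:
`a (n p) - a n ∈ n p ℤ_(p)` for all integers `n`. -/
def SatisfiesGaussCongruences (p : ℕ) (a : ℤ → ℚ) : Prop :=
  ∀ n : ℤ, ∃ z ∈ localizedInt p, a (n * (p : ℤ)) - a n = (n : ℚ) * (p : ℚ) * z

/-- The Gauss property: Gauss congruences hold for all but finitely many prime numbers. -/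
def HasGaussProperty (a : ℤ → ℚ) : Prop :=
  {p : ℕ | p.Prime ∧ ¬ SatisfiesGaussCongruences p a}.Finite

namespace PowerSeries

/-- The coefficient sequence of a power series, extended by `0` to negative indices. -/
noncomputable def intCoeff (F : ℚ⟦X⟧) (n : ℤ) : ℚ :=
  if 0 ≤ n then coeff n.toNat F else 0

/-- `F ∈ ℚ⟦X⟧` is globally bounded: its radius of convergence (over `ℂ`) is positive, and
`F(Cx) ∈ ℤ⟦x⟧` for some non-zero rational `C`. -/
def IsGloballyBounded (F : ℚ⟦X⟧) : Prop :=
  0 < (FormalMultilinearSeries.ofScalars ℂ (fun n : ℕ => ((coeff n F : ℚ) : ℂ))).radius ∧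
    ∃ C : ℚ, C ≠ 0 ∧ ∃ G : ℤ⟦X⟧, rescale C F = map (Int.castRingHom ℚ) G

end PowerSeries

/-- `(α₁)ₙ ⋯ (αᵣ)ₙ / ((β₁)ₙ ⋯ (βₛ)ₙ)`, with `(x)ₙ` the rising factorial. -/
noncomputable def hypergeometricTerm {r s : ℕ} (α : Fin r → ℚ) (β : Fin s → ℚ) (n : ℕ) : ℚ :=
  (∏ i, (ascPochhammer ℚ n).eval (α i)) / ∏ j, (ascPochhammer ℚ n).eval (β j)

/-- The hypergeometric series `𝓕_{α,β}`. -/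
noncomputable def hypergeometricSeries {r s : ℕ} (α : Fin r → ℚ) (β : Fin s → ℚ) : ℚ⟦X⟧ :=
  PowerSeries.mk (hypergeometricTerm α β)

/-- `(e₁ n)! ⋯ (e_u n)! / ((f₁ n)! ⋯ (f_v n)!)`. -/
def factorialRatio {u v : ℕ} (e : Fin u → ℕ) (f : Fin v → ℕ) (n : ℕ) : ℚ :=
  (∏ i, ((e i * n).factorial : ℚ)) / ∏ j, ((f j * n).factorial : ℚ)

/-- The series `F_{e,f}`. -/
def factorialRatioSeries {u v : ℕ} (e : Fin u → ℕ) (f : Fin v → ℕ) : ℚ⟦X⟧ :=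
  PowerSeries.mk (factorialRatio e f)

/-- A power series `F` is factorial if `F(Cx) = F_{e,f}(x)` for some non-zero rational `C` and some
tuples `e`, `f` of positive integers. -/
def PowerSeries.IsFactorial (F : ℚ⟦X⟧) : Prop :=
  ∃ C : ℚ, C ≠ 0 ∧ ∃ (u v : ℕ) (e : Fin u → ℕ) (f : Fin v → ℕ),
    (∀ i, 0 < e i) ∧ (∀ j, 0 < f j) ∧ PowerSeries.rescale C F = factorialRatioSeries e f

/-! Both directions rest on one comparison. If `d` is prime to `p`, exactly one in `p` consecutive
terms of a progression `a + k * d` is divisible by `p`. Pulling out these terms leaves a power of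
`p`, a shorter progression, and a product of integers prime to `p` whose residue depends only on its
length (`prod_arith_progression_eq`, `cast_prod_primeToPart`). When numerator and denominator are
balanced, the powers of `p` and the residues cancel. Global boundedness supplies the balance:
otherwise the terms, scaled geometrically, would tend to zero or grow too fast
(`card_eq_of_integral_of_bound`).

Factorial implies Gauss. Integrality after scaling, read at one large prime, gives Landau's floor
inequalities, hence integrality without scaling. The comparison modulo `p ^ (v_p(n) + 1)` then
yields the congruences at every prime (`factorialRatio_gauss`). Undoing the scaling costs only the
primes dividing the numerator or denominator of `C`.

Gauss implies factorial. Over a common denominator `d`, let `t` be inverse to `p` modulo `d`. For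
large `p`, the term at `n * p` is congruent modulo `p` to the term at `n` of Dwork's dual
parameters, obtained by multiplying numerators by `t` modulo `d`. Gauss congruences and Dirichlet's
theorem make the series equal to each of its duals. Hence the multiplicity of a residue among the
`α` minus that among the `β` is invariant under units modulo `d`. Möbius inversion over the divisors
of `d` writes it as an integer combination of indicators of multiples of `m ∣ d`, each being the
parameter set of `((d / m) * n)!`. -/

/-! ### Products over arithmetic progressions modulo prime powers -/

/-- The integer `x` if it is prime to `p`, and `1` otherwise. -/
def primeToPart (p : ℕ) (x : ℤ) : ℤ := if (p : ℤ) ∣ x then 1 else x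

theorem not_dvd_primeToPart {p : ℕ} (hp : p.Prime) (x : ℤ) : ¬ (p : ℤ) ∣ primeToPart p x := by
  unfold primeToPart
  split_ifs with h
  · intro h1
    have := Int.le_of_dvd one_pos h1
    have := hp.two_le
    omega
  · exact h

theorem not_dvd_prod_primeToPart {p : ℕ} (hp : p.Prime) {ι : Type*} (s : Finset ι) (f : ι → ℤ) :
    ¬ (p : ℤ) ∣ ∏ i ∈ s, primeToPart p (f i) := by
  rw [Prime.dvd_finsetProd_iff (Nat.prime_iff_prime_int.mp hp)]
  rintro ⟨i, -, h⟩
  exact not_dvd_primeToPart hp _ h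

/-- In the block of indices `n * p + k` with `k < p`, the term equals `p * (b + n * d) + (k - k₀) *
d`, so `p` divides it only for `k = k₀`. -/
theorem prod_arith_progression_eq {p : ℕ} (hp : p.Prime) {a b d : ℤ} {k₀ : ℕ}
    (hd : ¬ (p : ℤ) ∣ d) (hk : k₀ < p) (hb : a + k₀ * d = p * b) (n : ℕ) :
    ∏ k ∈ Finset.range (n * p), (a + k * d) = (p : ℤ) ^ n * (∏ j ∈ Finset.range n, (b + j * d)) *
      ∏ k ∈ Finset.range (n * p), primeToPart p (a + k * d) := by
  induction n with
  | zero => simp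
  | succ n ih =>
    have key : ∀ k ∈ Finset.range p, (a + ((n * p + k : ℕ) : ℤ) * d) =
        (if k = k₀ then (p : ℤ) * (b + n * d) else 1) *
          primeToPart p (a + ((n * p + k : ℕ) : ℤ) * d) := by
      intro k hk'
      rw [Finset.mem_range] at hk'
      have e : a + ((n * p + k : ℕ) : ℤ) * d = p * (b + n * d) + ((k : ℤ) - k₀) * d := by
        push_cast
        linear_combination hb
      unfold primeToPart
      rw [e]
      by_cases h : k = k₀
      · subst h
        simp
      · have h2 : ¬ (p : ℤ) ∣ p * (b + n * d) + ((k : ℤ) - k₀) * d := by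
          rw [dvd_add_right (dvd_mul_right _ _)]
          intro h3
          rcases (Nat.prime_iff_prime_int.mp hp).dvd_or_dvd h3 with h4 | h4
          · have := Int.eq_zero_of_abs_lt_dvd h4 (by rw [abs_lt]; constructor <;> omega)
            omega
          · exact hd h4
        simp [h, h2]
    rw [Nat.succ_mul, Finset.prod_range_succ, Finset.prod_range_add, Finset.prod_range_add, ih,
      Finset.prod_congr rfl key, Finset.prod_mul_distrib, Finset.prod_ite_eq',
      if_pos (Finset.mem_range.mpr hk), pow_succ]
    ring

theorem ZMod.prod_range_natCast {N : ℕ} [NeZero N] {M : Type*} [CommMonoid M] (f : ZMod N → M) :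
    ∏ k ∈ Finset.range N, f k = ∏ x, f x := by
  refine Finset.prod_nbij' (fun k => (k : ZMod N)) ZMod.val ?_ ?_ ?_ ?_ ?_
  · simp
  · intro x _
    simpa using ZMod.val_lt x
  · intro k hk
    exact ZMod.val_cast_of_lt (Finset.mem_range.mp hk)
  · simp
  · simp

open Classical in
/-- The product of the invertible residues modulo `N`. -/
noncomputable def unitProduct (N : ℕ) [NeZero N] : ZMod N :=
  ∏ x : ZMod N, if IsUnit x then x else 1

theorem isUnit_intCast_iff_not_dvd {p v N : ℕ} (hp : p.Prime) (hN : N = p ^ (v + 1)) (x : ℤ) :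
    IsUnit (x : ZMod N) ↔ ¬ (p : ℤ) ∣ x := by
  rw [ZMod.coe_int_isUnit_iff_isCoprime, hN, Nat.cast_pow, IsCoprime.pow_left_iff (Nat.succ_pos v),
    Prime.coprime_iff_not_dvd (Nat.prime_iff_prime_int.mp hp)]

open Classical in
theorem cast_primeToPart {p v N : ℕ} (hp : p.Prime) (hN : N = p ^ (v + 1)) (x : ℤ) :
    (primeToPart p x : ZMod N) = if IsUnit (x : ZMod N) then (x : ZMod N) else 1 := by
  have h := isUnit_intCast_iff_not_dvd hp hN x
  unfold primeToPart
  by_cases hx : (p : ℤ) ∣ x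
  · rw [if_pos hx, if_neg (by rw [h]; exact not_not.mpr hx), Int.cast_one]
  · rw [if_neg hx, if_pos (h.mpr hx)]

/-- Since `d` is a unit modulo `N`, any `N` consecutive terms run once through all residues. The
value of `unitProduct N` is never needed: it enters numerators and denominators to equal powers. -/
theorem cast_prod_primeToPart {p v N : ℕ} [NeZero N] (hp : p.Prime) (hN : N = p ^ (v + 1)) (q : ℕ)
    {a d : ℤ} (hd : ¬ (p : ℤ) ∣ d) :
    ((∏ k ∈ Finset.range (N * q), primeToPart p (a + k * d) : ℤ) : ZMod N) =
      unitProduct N ^ q := by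
  classical
  obtain ⟨u, hu⟩ := (isUnit_intCast_iff_not_dvd hp hN d).mpr hd
  rw [Int.cast_prod]
  induction q with
  | zero => simp
  | succ q ih =>
    rw [Nat.mul_succ, Finset.prod_range_add, ih, pow_succ]
    congr 1
    have h1 : ∀ k ∈ Finset.range N, (primeToPart p (a + ((N * q + k : ℕ) : ℤ) * d) : ZMod N) =
        if IsUnit ((a : ZMod N) + k * u) then (a : ZMod N) + k * u else 1 := by
      intro k _
      rw [cast_primeToPart hp hN]
      push_cast
      simp only [ZMod.natCast_self, zero_mul, zero_add, hu]
    rw [Finset.prod_congr rfl h1, ZMod.prod_range_natCast (fun x : ZMod N =>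
      if IsUnit ((a : ZMod N) + x * u) then (a : ZMod N) + x * u else 1)]
    exact Fintype.prod_equiv ((Units.mulRight u).trans (Equiv.addLeft (a : ZMod N))) _ _
      fun x => rfl

theorem mem_localizedInt_of_mul_eq {p : ℕ} {z : ℚ} {x y : ℤ}
    (hx : ¬ (p : ℤ) ∣ x) (h : z * x = y) : z ∈ localizedInt p := by
  intro hz
  have hx0 : (x : ℚ) ≠ 0 := by
    rintro h0
    apply hx
    simp [Int.cast_eq_zero.mp h0]
  have h1 : (z.den : ℤ) ∣ x := by
    have : z = (y : ℚ) / (x : ℚ) := by rw [← h]; field_simp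
    rw [this, ← Rat.divInt_eq_div]
    exact Rat.den_dvd y x
  exact hx ((Int.natCast_dvd_natCast.mpr hz).trans h1)

/-! ### Growth: equally many parameters above and below -/

open Filter Topology in
theorem tendsto_prod_add_natCast_div {ι κ : Type*} [Fintype ι] [Fintype κ] (α : ι → ℝ) (β : κ → ℝ)
    (h : Fintype.card ι < Fintype.card κ) :
    Tendsto (fun n : ℕ => (∏ i, (α i + n)) / ∏ j, (β j + n)) atTop (𝓝 0) := by
  have key := Polynomial.div_tendsto_atTop_zero_of_degree_lt
    (P := ∏ i, (Polynomial.X + Polynomial.C (α i))) (Q := ∏ j, (Polynomial.X + Polynomial.C (β j)))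
    (by rw [Polynomial.degree_prod, Polynomial.degree_prod]; simpa using h)
  refine (key.comp tendsto_natCast_atTop_atTop).congr fun n => ?_
  simp [Polynomial.eval_prod, add_comm]

theorem ascPochhammer_eval_ne_zero {x : ℚ} (hx : ∀ m : ℕ, x ≠ -(m : ℚ)) (n : ℕ) :
    (ascPochhammer ℚ n).eval x ≠ 0 := by
  induction n with
  | zero => simp
  | succ n ih =>
    rw [ascPochhammer_succ_eval]
    exact mul_ne_zero ih fun h => hx n (eq_neg_of_add_eq_zero_left h)

/-- `a n * C ^ n` is an integer for all `n`, for some non-zero rational `C`. -/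
def HasIntegralScaling (a : ℕ → ℚ) : Prop := ∃ C : ℚ, C ≠ 0 ∧ ∀ n, ∃ z : ℤ, C ^ n * a n = z

/-- `a` grows at most exponentially. -/
def HasExponentialBound (a : ℕ → ℚ) : Prop :=
  ∃ ρ : ℝ, 0 < ρ ∧ ∃ M : ℝ, ∀ n, |(a n : ℝ)| * ρ ^ n ≤ M

theorem HasIntegralScaling.of_rescale {a b : ℕ → ℚ} {c : ℚ} (hc : c ≠ 0)
    (h : ∀ n, b n = c ^ n * a n) (ha : HasIntegralScaling a) : HasIntegralScaling b := by
  obtain ⟨C, hC, H⟩ := ha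
  refine ⟨C / c, div_ne_zero hC hc, fun n => ?_⟩
  obtain ⟨z, hz⟩ := H n
  refine ⟨z, ?_⟩
  rw [← hz, h, div_pow]
  field_simp

theorem HasExponentialBound.of_rescale {a b : ℕ → ℚ} {c : ℚ} (hc : c ≠ 0)
    (h : ∀ n, b n = c ^ n * a n) (ha : HasExponentialBound a) : HasExponentialBound b := by
  obtain ⟨ρ, hρ, M, H⟩ := ha
  have hc' : 0 < |(c : ℝ)| := abs_pos.mpr (Rat.cast_ne_zero.mpr hc)
  refine ⟨ρ / |(c : ℝ)|, div_pos hρ hc', M, fun n => ?_⟩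
  refine le_trans (le_of_eq ?_) (H n)
  rw [h, div_pow]
  push_cast
  rw [abs_mul, abs_pow]
  field_simp

theorem PowerSeries.IsGloballyBounded.hasIntegralScaling {F : ℚ⟦X⟧} (hF : F.IsGloballyBounded) :
    HasIntegralScaling fun n => PowerSeries.coeff n F := by
  obtain ⟨-, C, hC, G, hG⟩ := hF
  refine ⟨C, hC, fun n => ⟨PowerSeries.coeff n G, ?_⟩⟩
  have := congrArg (PowerSeries.coeff n) hG
  simpa [PowerSeries.coeff_rescale] using this

theorem PowerSeries.IsGloballyBounded.hasExponentialBound {F : ℚ⟦X⟧} (hF : F.IsGloballyBounded) :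
    HasExponentialBound fun n => PowerSeries.coeff n F := by
  obtain ⟨ρ, h0, hρ⟩ := ENNReal.lt_iff_exists_nnreal_btwn.mp hF.1
  obtain ⟨M, -, hM⟩ := FormalMultilinearSeries.norm_mul_pow_le_of_lt_radius _ hρ
  refine ⟨ρ, by exact_mod_cast h0, M, fun n => ?_⟩
  have := hM n
  rw [FormalMultilinearSeries.ofScalars_norm] at this
  simpa using this

section Growth

variable {ι κ : Type*} [Fintype ι] [Fintype κ]

open Filter Topology in
theorem tendsto_pochhammer_quotient {α : ι → ℚ} {β : κ → ℚ}
    (hα : ∀ i, ∀ m : ℕ, α i ≠ -(m : ℚ)) (hβ : ∀ j, ∀ m : ℕ, β j ≠ -(m : ℚ))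
    (h : Fintype.card ι < Fintype.card κ) {c : ℝ} (hc : c ≠ 0) :
    Tendsto (fun n : ℕ => (((∏ i, (ascPochhammer ℚ n).eval (α i)) /
      ∏ j, (ascPochhammer ℚ n).eval (β j) : ℚ) : ℝ) * c ^ n) atTop (𝓝 0) := by
  refine (summable_of_ratio_test_tendsto_lt_one (l := 0) zero_lt_one
    (Eventually.of_forall fun n => ?_) ?_).tendsto_atTop_zero
  · refine mul_ne_zero (Rat.cast_ne_zero.mpr (div_ne_zero ?_ ?_)) (pow_ne_zero _ hc)
    · exact Finset.prod_ne_zero_iff.mpr fun i _ => ascPochhammer_eval_ne_zero (hα i) n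
    · exact Finset.prod_ne_zero_iff.mpr fun j _ => ascPochhammer_eval_ne_zero (hβ j) n
  · have key := ((tendsto_prod_add_natCast_div (fun i => (α i : ℝ)) (fun j => (β j : ℝ)) h).mul_const
      c).norm
    rw [zero_mul, norm_zero] at key
    refine key.congr fun n => ?_
    rw [← norm_div]
    congr 1
    have h1 : (((∏ i, (ascPochhammer ℚ n).eval (α i) : ℚ) : ℝ)) ≠ 0 := Rat.cast_ne_zero.mpr
      (Finset.prod_ne_zero_iff.mpr fun i _ => ascPochhammer_eval_ne_zero (hα i) n)
    have h2 : (((∏ j, (ascPochhammer ℚ n).eval (β j) : ℚ) : ℝ)) ≠ 0 := Rat.cast_ne_zero.mpr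
      (Finset.prod_ne_zero_iff.mpr fun j _ => ascPochhammer_eval_ne_zero (hβ j) n)
    have h3 : (∏ j, ((β j : ℝ) + n)) ≠ 0 := Finset.prod_ne_zero_iff.mpr fun j _ h0 =>
      hβ j n (by
        have : ((β j + n : ℚ) : ℝ) = 0 := by push_cast; exact h0
        exact eq_neg_of_add_eq_zero_left (Rat.cast_eq_zero.mp this))
    simp only [ascPochhammer_succ_eval, Finset.prod_mul_distrib, Rat.cast_div, Rat.cast_mul]
    have h4 : ((∏ i, (α i + (n : ℚ)) : ℚ) : ℝ) = ∏ i, ((α i : ℝ) + n) := by push_cast; rfl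
    have h5 : ((∏ j, (β j + (n : ℚ)) : ℚ) : ℝ) = ∏ j, ((β j : ℝ) + n) := by push_cast; rfl
    rw [h4, h5]
    field_simp
    ring

-- With fewer `α` than `β`, the non-zero integers `C ^ n * a n` would tend to zero. With more, `(a n
-- * ρ ^ n)⁻¹` would tend to zero, against the exponential bound.
open Filter Topology in
theorem card_eq_of_integral_of_bound {α : ι → ℚ} {β : κ → ℚ}
    (hα : ∀ i, ∀ m : ℕ, α i ≠ -(m : ℚ)) (hβ : ∀ j, ∀ m : ℕ, β j ≠ -(m : ℚ))
    (hI : HasIntegralScaling fun n => (∏ i, (ascPochhammer ℚ n).eval (α i)) /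
      ∏ j, (ascPochhammer ℚ n).eval (β j))
    (hB : HasExponentialBound fun n => (∏ i, (ascPochhammer ℚ n).eval (α i)) /
      ∏ j, (ascPochhammer ℚ n).eval (β j)) : Fintype.card ι = Fintype.card κ := by
  have hne : ∀ n, (∏ i, (ascPochhammer ℚ n).eval (α i)) /
      ∏ j, (ascPochhammer ℚ n).eval (β j) ≠ 0 := fun n => div_ne_zero
    (Finset.prod_ne_zero_iff.mpr fun i _ => ascPochhammer_eval_ne_zero (hα i) n)
    (Finset.prod_ne_zero_iff.mpr fun j _ => ascPochhammer_eval_ne_zero (hβ j) n)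
  rcases lt_trichotomy (Fintype.card ι) (Fintype.card κ) with h | h | h
  · exfalso
    obtain ⟨C, hC, H⟩ := hI
    have h1 := (tendsto_pochhammer_quotient hα hβ h (c := (C : ℝ)) (Rat.cast_ne_zero.mpr hC)).norm
    rw [norm_zero] at h1
    obtain ⟨n, hn⟩ := (h1.eventually_lt_const one_pos).exists
    obtain ⟨z, hz⟩ := H n
    have h2 : z ≠ 0 := by
      rintro rfl
      rw [Int.cast_zero] at hz
      exact mul_ne_zero (pow_ne_zero n hC) (hne n) hz
    have h3 := congrArg (fun x : ℚ => (x : ℝ)) hz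
    simp only [Rat.cast_mul, Rat.cast_pow, Rat.cast_intCast] at h3
    rw [mul_comm, h3, Real.norm_eq_abs] at hn
    have h4 : (1 : ℝ) ≤ |(z : ℝ)| := by exact_mod_cast Int.one_le_abs h2
    linarith
  · exact h
  · exfalso
    obtain ⟨ρ, hρ, M, H⟩ := hB
    have hM : 0 < M := lt_of_lt_of_le
      (mul_pos (abs_pos.mpr (Rat.cast_ne_zero.mpr (hne 0))) (pow_pos hρ 0)) (H 0)
    have h1 := (tendsto_pochhammer_quotient hβ hα h (inv_ne_zero hρ.ne')).norm
    rw [norm_zero] at h1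
    obtain ⟨n, hn⟩ := (h1.eventually_lt_const (inv_pos.mpr hM)).exists
    rw [← inv_div (∏ i, (ascPochhammer ℚ n).eval (α i)), Rat.cast_inv, inv_pow, ← mul_inv, norm_inv,
      inv_lt_inv₀ (norm_pos_iff.mpr (mul_ne_zero (Rat.cast_ne_zero.mpr (hne n))
        (pow_ne_zero n hρ.ne'))) hM, norm_mul, Real.norm_eq_abs, Real.norm_eq_abs,
      abs_of_pos (pow_pos hρ n)] at hn
    exact absurd (H n) (not_le.mpr hn)

end Growth

/-! ### Factorials as products of Pochhammer symbols -/

theorem factorial_mul_eq_prod_ascPochhammer {e : ℕ} (he : 0 < e) (n : ℕ) :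
    ((e * n).factorial : ℚ) =
      ((e : ℚ) ^ e) ^ n * ∏ k : Fin e, (ascPochhammer ℚ n).eval (((k : ℕ) + 1 : ℚ) / e) := by
  have he' : (e : ℚ) ≠ 0 := by exact_mod_cast he.ne'
  induction n with
  | zero => simp
  | succ n ih =>
    simp only [ascPochhammer_succ_eval, Finset.prod_mul_distrib]
    rw [Nat.mul_succ, ← Nat.factorial_mul_ascFactorial, Nat.cast_mul, ih,
      Nat.ascFactorial_eq_prod_range, pow_succ]
    have h : (((∏ i ∈ Finset.range e, (e * n + 1 + i) : ℕ)) : ℚ) =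
        (e : ℚ) ^ e * ∏ k : Fin e, (((k : ℕ) + 1 : ℚ) / e + n) := by
      rw [Finset.prod_range, ← Fin.prod_const, ← Finset.prod_mul_distrib]
      push_cast
      refine Finset.prod_congr rfl fun i _ => ?_
      field_simp
      ring
    rw [h]
    ring

theorem factorialRatio_eq_pochhammer_quotient {u v : ℕ} {e : Fin u → ℕ} {f : Fin v → ℕ}
    (he : ∀ i, 0 < e i) (hf : ∀ j, 0 < f j) (n : ℕ) :
    factorialRatio e f n = ((∏ i, (e i : ℚ) ^ e i) / ∏ j, (f j : ℚ) ^ f j) ^ n *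
      ((∏ x : (i : Fin u) × Fin (e i), (ascPochhammer ℚ n).eval (((x.2 : ℕ) + 1 : ℚ) / e x.1)) /
        ∏ x : (j : Fin v) × Fin (f j), (ascPochhammer ℚ n).eval (((x.2 : ℕ) + 1 : ℚ) / f x.1)) := by
  unfold factorialRatio
  rw [Finset.prod_congr rfl fun i _ => factorial_mul_eq_prod_ascPochhammer (he i) n,
    Finset.prod_congr rfl fun j _ => factorial_mul_eq_prod_ascPochhammer (hf j) n,
    Finset.prod_mul_distrib, Finset.prod_mul_distrib, Finset.prod_pow, Finset.prod_pow,
    Fintype.prod_sigma, Fintype.prod_sigma, div_pow, mul_div_mul_comm]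

/-- Each `(e i * n)!` contributes exactly `e i` Pochhammer factors, so this is the equality of
parameter counts. -/
theorem sum_eq_of_factorialRatio {u v : ℕ} {e : Fin u → ℕ} {f : Fin v → ℕ}
    (he : ∀ i, 0 < e i) (hf : ∀ j, 0 < f j) (hI : HasIntegralScaling (factorialRatio e f))
    (hB : HasExponentialBound (factorialRatio e f)) : ∑ i, e i = ∑ j, f j := by
  have hc : (∏ i, (e i : ℚ) ^ e i) / ∏ j, (f j : ℚ) ^ f j ≠ 0 := div_ne_zero
    (Finset.prod_ne_zero_iff.mpr fun i _ => pow_ne_zero _ (by exact_mod_cast (he i).ne'))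
    (Finset.prod_ne_zero_iff.mpr fun j _ => pow_ne_zero _ (by exact_mod_cast (hf j).ne'))
  have hpos : ∀ (k m : ℕ) {d : ℕ}, (((k : ℕ) + 1 : ℚ) / d) ≠ -(m : ℚ) ∨ d = 0 := by
    intro k m d
    rcases Nat.eq_zero_or_pos d with h | h
    · exact Or.inr h
    · left
      have : 0 < (((k : ℕ) + 1 : ℚ) / d) := by positivity
      have : (0 : ℚ) ≤ m := by positivity
      intro h
      linarith
  have hinv : ∀ n, (∏ x : (i : Fin u) × Fin (e i),
      (ascPochhammer ℚ n).eval (((x.2 : ℕ) + 1 : ℚ) / e x.1)) /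
        ∏ x : (j : Fin v) × Fin (f j), (ascPochhammer ℚ n).eval (((x.2 : ℕ) + 1 : ℚ) / f x.1) =
      (((∏ i, (e i : ℚ) ^ e i) / ∏ j, (f j : ℚ) ^ f j)⁻¹) ^ n * factorialRatio e f n := by
    intro n
    rw [factorialRatio_eq_pochhammer_quotient he hf, inv_pow,
      inv_mul_cancel_left₀ (pow_ne_zero n hc)]
  have := card_eq_of_integral_of_bound
    (α := fun x : (i : Fin u) × Fin (e i) => ((x.2 : ℕ) + 1 : ℚ) / e x.1)
    (β := fun x : (j : Fin v) × Fin (f j) => ((x.2 : ℕ) + 1 : ℚ) / f x.1)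
    (fun x m => (hpos x.2 m).resolve_right (he x.1).ne')
    (fun x m => (hpos x.2 m).resolve_right (hf x.1).ne')
    (hI.of_rescale (inv_ne_zero hc) hinv) (hB.of_rescale (inv_ne_zero hc) hinv)
  simpa using this

/-! ### Landau's criterion and integrality -/

section FactorialRatio

variable {u v : ℕ} {e : Fin u → ℕ} {f : Fin v → ℕ}

theorem padicValNat_prod_factorial {ι : Type*} [Fintype ι] (e : ι → ℕ) {p b n : ℕ}
    [hp : Fact p.Prime] (hb : ∀ i, Nat.log p (e i * n) < b) :
    padicValNat p (∏ i, (e i * n).factorial) = ∑ k ∈ Finset.Ico 1 b, ∑ i, e i * n / p ^ k := by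
  classical
  have h : ∀ s : Finset ι, padicValNat p (∏ i ∈ s, (e i * n).factorial) =
      ∑ i ∈ s, padicValNat p (e i * n).factorial := by
    intro s
    induction s using Finset.induction_on with
    | empty => simp
    | insert a s ha ih =>
      rw [Finset.prod_insert ha, Finset.sum_insert ha, padicValNat.mul (Nat.factorial_ne_zero _)
        (Finset.prod_ne_zero_iff.mpr fun i _ => Nat.factorial_ne_zero _), ih]
  rw [h, Finset.sum_comm]
  exact Finset.sum_congr rfl fun i _ => padicValNat_factorial (hb i)

/-- At a large prime `P`, the fraction `n / q` is approximated from above by some `m / P` so closely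
that no floor changes. The floors of `g * m / P` are then the `P`-adic valuations of the factorials
`(g * m)!`. -/
theorem sum_div_le_sum_div_of_integral (hI : HasIntegralScaling (factorialRatio e f)) (n : ℕ)
    {q : ℕ} (hq : 0 < q) : ∑ j, f j * n / q ≤ ∑ i, e i * n / q := by
  obtain ⟨C, hC, H⟩ := hI
  obtain ⟨P, hPlarge, hP⟩ := Nat.exists_infinite_primes
    (C.num.natAbs + 1 + ((∑ i, e i) + ∑ j, f j + 1) * (n + q + 1))
  set B := (∑ i, e i) + ∑ j, f j + 1 with hB
  have heB : ∀ i, e i ≤ B := fun i =>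
    (Finset.single_le_sum (fun _ _ => Nat.zero_le _) (Finset.mem_univ i)).trans (by omega)
  have hfB : ∀ j, f j ≤ B := fun j =>
    (Finset.single_le_sum (fun _ _ => Nat.zero_le _) (Finset.mem_univ j)).trans (by omega)
  have hPn : B * (n + q + 1) ≤ P := by omega
  have hP0 : 0 < P := hP.pos
  -- `m` is the ceiling of `n * P / q`, so `m / P` exceeds `n / q` by less than `1 / P`.
  obtain ⟨m, hm1, hm2⟩ : ∃ m, n * P ≤ q * m ∧ q * m < n * P + q := by
    refine ⟨(n * P + (q - 1)) / q, ?_, ?_⟩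
    · have := Nat.div_add_mod (n * P + (q - 1)) q
      have := Nat.mod_lt (n * P + (q - 1)) hq
      omega
    · have := Nat.div_add_mod (n * P + (q - 1)) q
      omega
  have hdiv : ∀ g ≤ B, g * m / P = g * n / q := by
    intro g hg
    have hgq : g * q ≤ P := le_trans (by nlinarith) hPn
    apply Nat.div_eq_of_lt_le
    · have h1 := Nat.div_mul_le_self (g * n) q
      have : q * (g * n / q * P) ≤ q * (g * m) := by nlinarith
      exact Nat.le_of_mul_le_mul_left this hq
    · have h1 : g * n + 1 ≤ (g * n / q + 1) * q := by
        have := Nat.div_add_mod (g * n) q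
        have := Nat.mod_lt (g * n) hq
        nlinarith
      rcases Nat.eq_zero_or_pos g with h0 | h0
      · subst h0
        simpa using hP0
      have h2 : g * (q * m) < g * (n * P + q) := Nat.mul_lt_mul_of_pos_left hm2 h0
      have : q * (g * m) < q * ((g * n / q + 1) * P) := by nlinarith
      exact Nat.lt_of_mul_lt_mul_left this
  -- As `g * m < P ^ 2`, only the first term of Legendre's formula survives.
  have hlog : ∀ g ≤ B, Nat.log P (g * m) < 2 := by
    intro g hg
    have hm : m ≤ n * P + 1 := by
      by_contra! h
      have h1 : q * (n * P + 2) ≤ q * m := Nat.mul_le_mul_left q h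
      have h2 : n * P ≤ q * (n * P) := Nat.le_mul_of_pos_left _ hq
      nlinarith
    apply Nat.log_lt_of_lt_pow' (by norm_num)
    have h1 : g * m ≤ B * (n * P + 1) := Nat.mul_le_mul hg hm
    have h2 : P * (B * (n + q + 1)) ≤ P * P := Nat.mul_le_mul_left P hPn
    have hB0 : 0 < B := by omega
    have h3 : B * (n * P + 1) < P * (B * (n + q + 1)) := by
      have : B * 1 ≤ B * P := Nat.mul_le_mul_left B hP0
      have : 0 < B * P * q := by positivity
      nlinarith
    nlinarith
  have : Fact P.Prime := ⟨hP⟩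
  have hEF : padicValNat P (∏ j, (f j * m).factorial) ≤
      padicValNat P (∏ i, (e i * m).factorial) := by
    obtain ⟨z, hz⟩ := H m
    have hE0 : ∏ i, (e i * m).factorial ≠ 0 :=
      Finset.prod_ne_zero_iff.mpr fun i _ => Nat.factorial_ne_zero _
    have hF0 : ∏ j, (f j * m).factorial ≠ 0 :=
      Finset.prod_ne_zero_iff.mpr fun i _ => Nat.factorial_ne_zero _
    have hdvd : ((∏ j, (f j * m).factorial : ℕ) : ℤ) ∣
        C.num ^ m * (∏ i, (e i * m).factorial : ℕ) := by
      refine ⟨z * C.den ^ m, ?_⟩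
      have hF0' : ((∏ j, (f j * m).factorial : ℕ) : ℚ) ≠ 0 := Nat.cast_ne_zero.mpr hF0
      have hd : (C.den : ℚ) ≠ 0 := Nat.cast_ne_zero.mpr C.den_nz
      rw [← Rat.num_div_den C, div_pow] at hz
      have : factorialRatio e f m = ((∏ i, (e i * m).factorial : ℕ) : ℚ) /
          ((∏ j, (f j * m).factorial : ℕ) : ℚ) := by
        unfold factorialRatio
        push_cast
        rfl
      rw [this] at hz
      have hz' : (C.num : ℚ) ^ m * ((∏ i, (e i * m).factorial : ℕ) : ℚ) =
          ((∏ j, (f j * m).factorial : ℕ) : ℚ) * (z * (C.den : ℚ) ^ m) := by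
        rw [← hz]
        field_simp
      exact_mod_cast hz'
    -- `P` exceeds the absolute value of the numerator of `C`, so scaling cannot supply factors `P`.
    have hcop : IsCoprime ((P : ℤ) ^ padicValNat P (∏ j, (f j * m).factorial)) (C.num ^ m) := by
      apply IsCoprime.pow
      rw [Prime.coprime_iff_not_dvd (Nat.prime_iff_prime_int.mp hP)]
      intro h
      have h1 := Nat.le_of_dvd (Int.natAbs_pos.mpr (Rat.num_ne_zero.mpr hC))
        (Int.natCast_dvd.mp h)
      omega
    have h1 : ((P : ℤ) ^ padicValNat P (∏ j, (f j * m).factorial)) ∣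
        ((∏ j, (f j * m).factorial : ℕ) : ℤ) := by
      exact_mod_cast pow_padicValNat_dvd
    have h2 := hcop.dvd_of_dvd_mul_left (h1.trans hdvd)
    rw [← padicValNat_dvd_iff_le hE0]
    exact_mod_cast h2
  rw [padicValNat_prod_factorial f (b := 2) fun j => hlog _ (hfB j),
    padicValNat_prod_factorial e (b := 2) fun i => hlog _ (heB i)] at hEF
  simpa [hdiv _ (heB _), hdiv _ (hfB _)] using hEF

/-- Legendre's formula sums the floor inequalities over `q = p ^ k`. -/
theorem factorialRatio_integral (hI : HasIntegralScaling (factorialRatio e f)) (n : ℕ) :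
    ∃ z : ℤ, factorialRatio e f n = z := by
  have hE0 : ∏ i, (e i * n).factorial ≠ 0 :=
    Finset.prod_ne_zero_iff.mpr fun i _ => Nat.factorial_ne_zero _
  have hF0 : ∏ j, (f j * n).factorial ≠ 0 :=
    Finset.prod_ne_zero_iff.mpr fun i _ => Nat.factorial_ne_zero _
  have hdvd : (∏ j, (f j * n).factorial) ∣ ∏ i, (e i * n).factorial := by
    rw [Nat.dvd_iff_prime_pow_dvd_dvd]
    intro p k hp hk
    have : Fact p.Prime := ⟨hp⟩
    rw [padicValNat_dvd_iff_le hE0]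
    rw [padicValNat_dvd_iff_le hF0] at hk
    refine hk.trans ?_
    have hb : ∃ b, (∀ i, Nat.log p (e i * n) < b) ∧ ∀ j, Nat.log p (f j * n) < b := by
      refine ⟨(∑ i, Nat.log p (e i * n)) + (∑ j, Nat.log p (f j * n)) + 1, fun i => ?_, fun j => ?_⟩
      · have := Finset.single_le_sum (f := fun i => Nat.log p (e i * n))
          (fun _ _ => Nat.zero_le _) (Finset.mem_univ i)
        omega
      · have := Finset.single_le_sum (f := fun j => Nat.log p (f j * n))
          (fun _ _ => Nat.zero_le _) (Finset.mem_univ j)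
        omega
    obtain ⟨b, hb1, hb2⟩ := hb
    rw [padicValNat_prod_factorial f hb2, padicValNat_prod_factorial e hb1]
    exact Finset.sum_le_sum fun k _ => sum_div_le_sum_div_of_integral hI n (pow_pos hp.pos k)
  obtain ⟨z, hz⟩ := hdvd
  refine ⟨z, ?_⟩
  have hF0' : ((∏ j, (f j * n).factorial : ℕ) : ℚ) ≠ 0 := Nat.cast_ne_zero.mpr hF0
  have : factorialRatio e f n = ((∏ i, (e i * n).factorial : ℕ) : ℚ) /
      ((∏ j, (f j * n).factorial : ℕ) : ℚ) := by
    unfold factorialRatio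
    push_cast
    rfl
  rw [this, hz, Nat.cast_mul, mul_div_cancel_left₀ _ hF0', Int.cast_natCast]

/-! ### Gauss congruences for factorial ratios -/

theorem factorial_mul_prime {p : ℕ} (hp : p.Prime) (m : ℕ) :
    ((m * p).factorial : ℤ) = (p : ℤ) ^ m * m.factorial *
      ∏ k ∈ Finset.range (m * p), primeToPart p (1 + k * 1) := by
  have hfac : ∀ M : ℕ, ∏ k ∈ Finset.range M, ((1 : ℤ) + k * 1) = M.factorial := by
    intro M
    rw [← Finset.prod_range_add_one_eq_factorial]
    push_cast
    exact Finset.prod_congr rfl fun _ _ => by ring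
  have := prod_arith_progression_eq hp (a := 1) (b := 1) (d := 1) (k₀ := p - 1)
    (fun h => hp.one_lt.ne' (by exact_mod_cast Int.eq_one_of_dvd_one (by positivity) h))
    (Nat.sub_lt hp.pos one_pos) (by rw [Nat.cast_sub hp.one_le]; push_cast; ring) m
  rwa [hfac, hfac] at this

theorem pow_mul_sub_one_cast_eq_one {p w N q n : ℕ} (hp : p.Prime) (hN : N = p ^ (w + 1))
    (hn : n = p ^ w * q) {x : ℤ} (hx : ¬ (p : ℤ) ∣ x) : (x : ZMod N) ^ (n * (p - 1)) = 1 := by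
  obtain ⟨t, ht⟩ := (isUnit_intCast_iff_not_dvd hp hN x).mpr hx
  have : n * (p - 1) = N.totient * q := by
    rw [hN, Nat.totient_prime_pow_succ hp, hn]
    ring
  rw [← ht, this, pow_mul, ← Units.val_pow_eq_pow_val, ZMod.pow_totient, Units.val_one, one_pow]

/-- The factor `x / y` covers both uses: `1` for the factorial series itself and `C⁻¹` for the
hypergeometric series. -/
theorem factorialRatio_gauss {p : ℕ} (hp : p.Prime) (hsum : ∑ i, e i = ∑ j, f j)
    (hint : ∀ n, ∃ z : ℤ, factorialRatio e f n = z) {x y : ℤ} (hx : ¬ (p : ℤ) ∣ x)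
    (hy : ¬ (p : ℤ) ∣ y) {n : ℕ} (hn : 0 < n) :
    ∃ z ∈ localizedInt p, ((x : ℚ) / y) ^ (n * p) * factorialRatio e f (n * p) -
      ((x : ℚ) / y) ^ n * factorialRatio e f n = n * p * z := by
  obtain ⟨w, q, hq, hnq⟩ := Nat.exists_eq_pow_mul_and_not_dvd hn.ne' p hp.ne_one
  obtain ⟨N, hN⟩ : ∃ N, N = p ^ (w + 1) := ⟨_, rfl⟩
  have : NeZero N := ⟨by rw [hN]; exact pow_ne_zero _ hp.ne_zero⟩
  have hpI := Nat.prime_iff_prime_int.mp hp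
  obtain ⟨A, hA⟩ := hint n
  set U : ℕ → ℤ := fun g => ∏ k ∈ Finset.range (g * n * p), primeToPart p (1 + k * 1) with hU
  have hUp : ∀ g, ¬ (p : ℤ) ∣ U g := fun g => not_dvd_prod_primeToPart hp _ _
  have hUc : ∀ g, (U g : ZMod N) = (unitProduct N ^ q) ^ g := by
    intro g
    have h1 : g * n * p = N * (q * g) := by
      rw [hN, hnq]
      ring
    simp only [hU]
    rw [h1, cast_prod_primeToPart hp hN (q * g)
      (fun h => hp.one_lt.ne' (by exact_mod_cast Int.eq_one_of_dvd_one (by positivity) h)), pow_mul]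
  have hfac : ∀ g : ℕ, ((g * (n * p)).factorial : ℚ) =
      ((p : ℚ) ^ n) ^ g * (g * n).factorial * (U g : ℚ) := by
    intro g
    have h1 := factorial_mul_prime hp (g * n)
    rw [← mul_assoc]
    have h2 := congrArg (fun t : ℤ => (t : ℚ)) h1
    simp only [Int.cast_mul, Int.cast_pow, Int.cast_natCast] at h2
    rw [h2, ← pow_mul, mul_comm n g]
  set E : ℤ := ∏ i, U (e i) with hE
  set F : ℤ := ∏ j, U (f j) with hF
  have hFp : ¬ (p : ℤ) ∣ F := by
    rw [hF, Prime.dvd_finsetProd_iff hpI]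
    rintro ⟨j, -, h⟩
    exact hUp _ h
  have ne : ∀ {t : ℤ}, ¬ (p : ℤ) ∣ t → (t : ℚ) ≠ 0 := by
    intro t ht h0
    exact ht (by simp [Int.cast_eq_zero.mp h0])
  have hF0 : (F : ℚ) ≠ 0 := ne hFp
  have hratio : factorialRatio e f (n * p) = factorialRatio e f n * (E / F) := by
    have hp0 : ((p : ℚ) ^ n) ^ (∑ j, f j) ≠ 0 :=
      pow_ne_zero _ (pow_ne_zero _ (Nat.cast_ne_zero.mpr hp.ne_zero))
    unfold factorialRatio
    simp only [hfac, Finset.prod_mul_distrib, Finset.prod_pow_eq_pow_sum, hsum]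
    rw [hE, hF, mul_div_mul_comm, mul_div_mul_left _ _ hp0]
    push_cast
    rfl
  -- The powers of `x` and `y` are `1` modulo `N` by Euler's theorem; `E` and `F` are the same power
  -- of `unitProduct N` because the sums of `e` and `f` agree.
  have hcong : (N : ℤ) ∣ x ^ (n * (p - 1)) * E - y ^ (n * (p - 1)) * F := by
    rw [← ZMod.intCast_zmod_eq_zero_iff_dvd]
    push_cast
    rw [pow_mul_sub_one_cast_eq_one hp hN hnq hx, pow_mul_sub_one_cast_eq_one hp hN hnq hy, hE, hF,
      Int.cast_prod, Int.cast_prod]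
    simp only [hUc, Finset.prod_pow_eq_pow_sum, hsum, sub_self]
  obtain ⟨t, ht⟩ := hcong
  have htQ : (x : ℚ) ^ (n * (p - 1)) * E - (y : ℚ) ^ (n * (p - 1)) * F = (p : ℚ) ^ (w + 1) * t := by
    have := congrArg (fun t : ℤ => (t : ℚ)) ht
    simp only [hN] at this
    push_cast at this
    exact this
  have hq' : ¬ (p : ℤ) ∣ (q : ℤ) := fun h => hq (Int.natCast_dvd_natCast.mp h)
  have hy0 := ne hy
  have hq0 : (q : ℚ) ≠ 0 := by exact_mod_cast ne hq'
  have hden : ¬ (p : ℤ) ∣ y ^ n * q * y ^ (n * (p - 1)) * F := by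
    intro h
    rcases hpI.dvd_or_dvd h with h | h
    · rcases hpI.dvd_or_dvd h with h | h
      · rcases hpI.dvd_or_dvd h with h | h
        · exact hy (hpI.dvd_of_dvd_pow h)
        · exact hq' h
      · exact hy (hpI.dvd_of_dvd_pow h)
    · exact hFp h
  refine ⟨((x : ℚ) ^ n * A * t) / (y ^ n * q * y ^ (n * (p - 1)) * F),
    mem_localizedInt_of_mul_eq hden (y := x ^ n * A * t) ?_, ?_⟩
  · push_cast
    rw [div_mul_cancel₀]
    have := ne hden
    push_cast at this
    exact this
  · have hnp : n * p = n + n * (p - 1) := by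
      conv_lhs => rw [← Nat.add_sub_cancel' hp.one_le, mul_add, mul_one]
    rw [hratio, hA, hnp, div_pow, div_pow, pow_add, pow_add]
    -- Since `q` is prime to `p`, divisibility by `N = p ^ (w + 1)` amounts to divisibility by `n *
    -- p` in `ℤ_(p)`.
    have hnQ : (n : ℚ) * p = (p : ℚ) ^ (w + 1) * q := by
      rw [hnq]
      push_cast
      ring
    rw [hnQ]
    field_simp
    linear_combination (x : ℚ) ^ n * A * htQ

end FactorialRatio

/-! ### Closure properties of scaled factorial ratios -/

/-- `a n * C ^ n` is the factorial ratio `F_{e,f}` for some non-zero `C`. -/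
def IsScaledFactorialRatio (a : ℕ → ℚ) : Prop :=
  ∃ C : ℚ, C ≠ 0 ∧ ∃ (u v : ℕ) (e : Fin u → ℕ) (f : Fin v → ℕ),
    (∀ i, 0 < e i) ∧ (∀ j, 0 < f j) ∧ ∀ n, C ^ n * a n = factorialRatio e f n

namespace IsScaledFactorialRatio

theorem one : IsScaledFactorialRatio fun _ => 1 :=
  ⟨1, one_ne_zero, 0, 0, Fin.elim0, Fin.elim0, fun i => i.elim0, fun i => i.elim0, fun n => by
    simp [factorialRatio]⟩

theorem mul {a b : ℕ → ℚ} (ha : IsScaledFactorialRatio a) (hb : IsScaledFactorialRatio b) :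
    IsScaledFactorialRatio fun n => a n * b n := by
  obtain ⟨C, hC, u, v, e, f, he, hf, h⟩ := ha
  obtain ⟨C', hC', u', v', e', f', he', hf', h'⟩ := hb
  refine ⟨C * C', mul_ne_zero hC hC', u + u', v + v', Fin.append e e', Fin.append f f', ?_, ?_, ?_⟩
  · exact fun i => Fin.addCases (fun i => by simpa using he i) (fun i => by simpa using he' i) i
  · exact fun i => Fin.addCases (fun i => by simpa using hf i) (fun i => by simpa using hf' i) i
  · intro n
    rw [mul_pow, mul_mul_mul_comm, h, h']
    unfold factorialRatio
    rw [Fin.prod_univ_add, Fin.prod_univ_add, div_mul_div_comm]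
    simp

theorem inv {a : ℕ → ℚ} (ha : IsScaledFactorialRatio a) :
    IsScaledFactorialRatio fun n => (a n)⁻¹ := by
  obtain ⟨C, hC, u, v, e, f, he, hf, h⟩ := ha
  refine ⟨C⁻¹, inv_ne_zero hC, v, u, f, e, hf, he, fun n => ?_⟩
  rw [inv_pow, ← mul_inv, h]
  unfold factorialRatio
  rw [inv_div]

theorem pow {a : ℕ → ℚ} (ha : IsScaledFactorialRatio a) (k : ℕ) :
    IsScaledFactorialRatio fun n => a n ^ k := by
  induction k with
  | zero => simpa using one
  | succ k ih => simpa only [pow_succ] using ih.mul ha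

theorem zpow {a : ℕ → ℚ} (ha : IsScaledFactorialRatio a) (k : ℤ) :
    IsScaledFactorialRatio fun n => a n ^ k := by
  cases k with
  | ofNat k => simpa using ha.pow k
  | negSucc k => simpa only [zpow_negSucc] using (ha.pow (k + 1)).inv

theorem prod {ι : Type*} (s : Finset ι) {a : ι → ℕ → ℚ}
    (ha : ∀ i ∈ s, IsScaledFactorialRatio (a i)) :
    IsScaledFactorialRatio fun n => ∏ i ∈ s, a i n := by
  classical
  induction s using Finset.induction_on with
  | empty => simpa using one
  | insert i s hi ih =>
    simp only [Finset.prod_insert hi]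
    exact (ha i (Finset.mem_insert_self i s)).mul
      (ih fun j hj => ha j (Finset.mem_insert_of_mem hj))

theorem prod_ascPochhammer {e : ℕ} (he : 0 < e) : IsScaledFactorialRatio fun n =>
    ∏ k : Fin e, (ascPochhammer ℚ n).eval (((k : ℕ) + 1 : ℚ) / e) := by
  refine ⟨(e : ℚ) ^ e, pow_ne_zero _ (by exact_mod_cast he.ne'), 1, 0, fun _ => e, Fin.elim0,
    fun _ => he, fun i => i.elim0, fun n => ?_⟩
  rw [← factorial_mul_eq_prod_ascPochhammer he]
  simp [factorialRatio]

end IsScaledFactorialRatio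

/-! ### Residue representatives and Dwork's dual parameters -/

namespace ZMod

variable {d : ℕ}

/-- The representative of a residue class modulo `d` in `{1, …, d}`. -/
def posRep (x : ZMod d) : ℕ := (x - 1).val + 1

theorem posRep_pos (x : ZMod d) : 0 < x.posRep := Nat.succ_pos _

theorem posRep_natCast {k : ℕ} (h0 : 0 < k) (hk : k ≤ d) : (k : ZMod d).posRep = k := by
  obtain ⟨k, rfl⟩ := Nat.exists_eq_succ_of_ne_zero h0.ne'
  simp [posRep, ZMod.val_natCast, Nat.mod_eq_of_lt (Nat.lt_of_succ_le hk)]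

variable [NeZero d]

theorem posRep_le (x : ZMod d) : x.posRep ≤ d := Nat.succ_le_of_lt (ZMod.val_lt _)

theorem natCast_posRep (x : ZMod d) : (x.posRep : ZMod d) = x := by
  simp [posRep]

theorem posRep_injective : Function.Injective (posRep : ZMod d → ℕ) := fun x y h => by
  rw [← natCast_posRep x, h, natCast_posRep]

theorem posRep_div_ne_neg (x : ZMod d) (m : ℕ) : (x.posRep : ℚ) / d ≠ -(m : ℚ) := by
  have h1 : (0 : ℚ) < x.posRep := by exact_mod_cast x.posRep_pos
  have h2 : (0 : ℚ) < d := by exact_mod_cast NeZero.pos d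
  have h3 : (0 : ℚ) ≤ m := by positivity
  have := div_pos h1 h2
  intro h
  linarith

/-- This locates the multiple of `p` among the first `p` terms. Representatives in `{1, …, d}` give
fractions in `(0, 1]`, so dual parameters are never integers `≤ 0`. -/
theorem exists_add_mul_eq_mul_posRep {a : ℤ} {p : ℕ} (ha : ∀ m : ℕ, a ≠ -(m * d))
    (hap : a.natAbs < p) {y : ZMod d} (hy : (p : ZMod d) * y = a) :
    ∃ k₀ : ℕ, k₀ < p ∧ a + k₀ * d = p * y.posRep := by
  have h1 : ((p * y.posRep - a : ℤ) : ZMod d) = 0 := by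
    push_cast
    rw [natCast_posRep, hy, sub_self]
  rw [ZMod.intCast_zmod_eq_zero_iff_dvd] at h1
  obtain ⟨k, hk⟩ := h1
  have hd : (0 : ℤ) < d := by exact_mod_cast NeZero.pos d
  have hy1 : (1 : ℤ) ≤ y.posRep := by exact_mod_cast y.posRep_pos
  have hyd : (y.posRep : ℤ) ≤ d := by exact_mod_cast y.posRep_le
  have hk0 : 0 ≤ k := by
    by_contra! h
    have : (p : ℤ) ≤ p * y.posRep := by nlinarith
    have : (d : ℤ) * k < 0 := by nlinarith
    omega
  have hkp : k < p := by
    rcases hyd.lt_or_eq with h | h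
    · have h2 : (p : ℤ) * y.posRep ≤ p * (d - 1) := by nlinarith
      have : (d : ℤ) * k < d * p := by nlinarith [abs_lt.mp (show |a| < p by rw [Int.abs_eq_natAbs]; exact_mod_cast hap)]
      exact lt_of_mul_lt_mul_left this hd.le
    -- When the representative is `d`, an index `k ≥ p` would force `a = -(k - p) * d`, which is
    -- excluded.
    · rw [h] at hk
      by_contra! h2
      apply ha (k - p).toNat
      rw [Int.toNat_of_nonneg (by omega)]
      linear_combination -hk
  refine ⟨k.toNat, by omega, ?_⟩
  rw [Int.toNat_of_nonneg hk0]
  linear_combination -hk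

end ZMod

theorem ascPochhammer_eval_div (a : ℤ) {d : ℕ} (hd : 0 < d) (n : ℕ) :
    (ascPochhammer ℚ n).eval ((a : ℚ) / d) =
      ((∏ k ∈ Finset.range n, (a + k * d) : ℤ) : ℚ) / (d : ℚ) ^ n := by
  have hd' : (d : ℚ) ≠ 0 := by exact_mod_cast hd.ne'
  induction n with
  | zero => simp
  | succ n ih =>
    rw [ascPochhammer_succ_eval, ih, Finset.prod_range_succ, Int.cast_mul]
    generalize ∏ k ∈ Finset.range n, (a + k * d : ℤ) = P
    push_cast
    field_simp
    ring

theorem exists_common_denominator {ι : Type*} [Fintype ι] (α : ι → ℚ) :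
    ∃ d : ℕ, 0 < d ∧ ∀ m, d ∣ m → 0 < m → ∀ i, ∃ a : ℤ, α i = a / m := by
  classical
  refine ⟨∏ i, (α i).den, Finset.prod_pos fun i _ => (α i).den_pos, fun m hm hm0 i => ?_⟩
  obtain ⟨k, rfl⟩ := (Finset.dvd_prod_of_mem (fun i => (α i).den) (Finset.mem_univ i)).trans hm
  refine ⟨(α i).num * k, ?_⟩
  have h1 : ((α i).den : ℚ) ≠ 0 := by exact_mod_cast (α i).den_nz
  have h2 : (k : ℚ) ≠ 0 := by
    rintro h
    simp [Nat.cast_eq_zero.mp h] at hm0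
  conv_lhs => rw [← Rat.num_div_den (α i)]
  push_cast
  field_simp

/-! ### Gauss congruences force equality with the dual series -/

section Converse

variable {r d : ℕ} [NeZero d]

theorem hypergeometricTerm_intCast_div {a b : Fin r → ℤ} (n : ℕ) :
    hypergeometricTerm (fun i => (a i : ℚ) / d) (fun j => (b j : ℚ) / d) n =
      ((∏ i, ∏ k ∈ Finset.range n, (a i + k * d) : ℤ) : ℚ) /
        ((∏ j, ∏ k ∈ Finset.range n, (b j + k * d) : ℤ) : ℚ) := by
  have hd : (d : ℚ) ≠ 0 := by exact_mod_cast NeZero.ne d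
  unfold hypergeometricTerm
  simp only [ascPochhammer_eval_div _ (NeZero.pos d)]
  rw [Finset.prod_div_distrib, Finset.prod_div_distrib, Finset.prod_const,
    div_div_div_cancel_right₀ (pow_ne_zero _ (pow_ne_zero _ hd))]
  push_cast
  rfl

/-- The comparison of a hypergeometric term of index `n * p` with the term of index `n` of its
Dwork-dual parameters. -/
theorem hypergeometricTerm_mul_prime {a b : Fin r → ℤ} {p : ℕ} (hp : p.Prime) (hpd : ¬ p ∣ d)
    (ha : ∀ i, ∀ m : ℕ, a i ≠ -(m * d)) (hb : ∀ j, ∀ m : ℕ, b j ≠ -(m * d))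
    (hap : ∀ i, (a i).natAbs < p) (hbp : ∀ j, (b j).natAbs < p) (t : (ZMod d)ˣ)
    (ht : (p : ZMod d) * t = 1) (n : ℕ) :
    ∃ E F : ℤ, ¬ (p : ℤ) ∣ F ∧ (p : ℤ) ∣ E - F ∧
      hypergeometricTerm (fun i => (a i : ℚ) / d) (fun j => (b j : ℚ) / d) (n * p) * F =
        hypergeometricTerm (fun i => ((t * a i : ZMod d).posRep : ℚ) / d)
          (fun j => ((t * b j : ZMod d).posRep : ℚ) / d) n * E := by
  have hpI := Nat.prime_iff_prime_int.mp hp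
  have hpd' : ¬ (p : ℤ) ∣ (d : ℤ) := fun h => hpd (Int.natCast_dvd_natCast.mp h)
  have := NeZero.mk hp.ne_zero
  set U : ℤ → ℤ := fun x => ∏ k ∈ Finset.range (n * p), primeToPart p (x + k * d) with hU
  have hUp : ∀ x, ¬ (p : ℤ) ∣ U x := fun x => not_dvd_prod_primeToPart hp _ _
  have hUc : ∀ x, (U x : ZMod p) = unitProduct p ^ n := by
    intro x
    simp only [hU]
    rw [mul_comm n p]
    exact cast_prod_primeToPart (v := 0) hp (by simp) n hpd'
  have key : ∀ x : ℤ, (∀ m : ℕ, x ≠ -(m * d)) → x.natAbs < p →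
      ∏ k ∈ Finset.range (n * p), (x + k * d) = (p : ℤ) ^ n *
        (∏ k ∈ Finset.range n, (((t * x : ZMod d).posRep : ℤ) + k * d)) * U x := by
    intro x hx hxp
    obtain ⟨k₀, hk, h⟩ := ZMod.exists_add_mul_eq_mul_posRep hx hxp (y := (t * x : ZMod d))
      (by rw [← mul_assoc, ht, one_mul])
    exact prod_arith_progression_eq hp hpd' hk h n
  refine ⟨∏ i, U (a i), ∏ j, U (b j), ?_, ?_, ?_⟩
  · rw [Prime.dvd_finsetProd_iff hpI]
    rintro ⟨j, -, h⟩
    exact hUp _ h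
  · rw [← ZMod.intCast_zmod_eq_zero_iff_dvd]
    push_cast
    simp only [hUc, Finset.prod_const, Finset.card_univ, sub_self]
  · have h1 := hypergeometricTerm_intCast_div (d := d)
      (a := fun i => ((t * a i : ZMod d).posRep : ℤ)) (b := fun j => ((t * b j : ZMod d).posRep : ℤ)) n
    simp only [Int.cast_natCast] at h1
    rw [h1, hypergeometricTerm_intCast_div, Finset.prod_congr rfl fun i _ => key (a i) (ha i) (hap i),
      Finset.prod_congr rfl fun j _ => key (b j) (hb j) (hbp j)]
    simp only [Finset.prod_mul_distrib, Finset.prod_const]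
    have hF0 : ((∏ j, U (b j) : ℤ) : ℚ) ≠ 0 := by
      rw [Int.cast_ne_zero, Finset.prod_ne_zero_iff]
      intro j _ h0
      exact hUp (b j) (h0 ▸ dvd_zero _)
    -- The powers of `p` cancel because both parameter tuples have length `r`.
    have hp0 : ((p : ℚ) ^ n) ^ r ≠ 0 :=
      pow_ne_zero _ (pow_ne_zero _ (Nat.cast_ne_zero.mpr hp.ne_zero))
    simp only [Finset.card_univ, Fintype.card_fin]
    rw [Int.cast_mul, Int.cast_mul, Int.cast_mul, Int.cast_mul, Int.cast_pow, Int.cast_pow,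
      Int.cast_natCast, mul_div_mul_comm, mul_div_mul_left _ _ hp0, mul_assoc,
      div_mul_cancel₀ _ hF0]

/-- Both sides are fixed rationals that agree modulo every large prime `p` inverse to `t` modulo
`d`; Dirichlet's theorem provides such a prime not dividing the numerator of a non-zero difference.
-/
theorem hypergeometricTerm_eq_of_hasGaussProperty {a b : Fin r → ℤ}
    (ha : ∀ i, ∀ m : ℕ, a i ≠ -(m * d)) (hb : ∀ j, ∀ m : ℕ, b j ≠ -(m * d))
    (hG : HasGaussProperty (hypergeometricSeries (fun i => (a i : ℚ) / d)
      (fun j => (b j : ℚ) / d)).intCoeff) (t : (ZMod d)ˣ) (n : ℕ) :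
    hypergeometricTerm (fun i => (a i : ℚ) / d) (fun j => (b j : ℚ) / d) n =
      hypergeometricTerm (fun i => ((t * a i : ZMod d).posRep : ℚ) / d)
        (fun j => ((t * b j : ZMod d).posRep : ℚ) / d) n := by
  set A : ℕ → ℚ := hypergeometricTerm (fun i => (a i : ℚ) / d) (fun j => (b j : ℚ) / d) with hA
  set B := hypergeometricTerm (fun i => ((t * a i : ZMod d).posRep : ℚ) / d)
        (fun j => ((t * b j : ZMod d).posRep : ℚ) / d) n with hB
  by_contra hne
  obtain ⟨M, hM⟩ := hG.bddAbove
  -- The bound places `p` beyond the exceptional primes, `d`, all `|a i|` and `|b j|`, and the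
  -- integers that `p` must not divide at the end.
  obtain ⟨p, hpl, hp, hpt⟩ := Nat.forall_exists_prime_gt_and_eq_mod (t⁻¹).isUnit
    (M + d + (∑ i, (a i).natAbs) + (∑ j, (b j).natAbs) + (B - A n).num.natAbs + B.den)
  have hpI := Nat.prime_iff_prime_int.mp hp
  have hgauss : SatisfiesGaussCongruences p (hypergeometricSeries (fun i => (a i : ℚ) / d)
      (fun j => (b j : ℚ) / d)).intCoeff := by
    by_contra h
    have := hM ⟨hp, h⟩
    omega
  obtain ⟨E, F, hF, ⟨s, hs⟩, hEF⟩ := hypergeometricTerm_mul_prime hp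
    (fun h => by have := Nat.le_of_dvd (NeZero.pos d) h; omega) ha hb
    (fun i => by
      have := Finset.single_le_sum (f := fun i => (a i).natAbs)
        (fun _ _ => Nat.zero_le _) (Finset.mem_univ i)
      omega)
    (fun j => by
      have := Finset.single_le_sum (f := fun j => (b j).natAbs)
        (fun _ _ => Nat.zero_le _) (Finset.mem_univ j)
      omega) t (by rw [hpt, Units.inv_mul]) n
  rw [← hA, ← hB] at hEF
  obtain ⟨z, hz, hzeq⟩ := hgauss n
  have hzeq' : A (n * p) - A n = n * p * z := by
    have h0 : (0 : ℤ) ≤ n * p := by positivity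
    have h1 : ((n : ℤ) * p).toNat = n * p := by
      rw [← Nat.cast_mul, Int.toNat_natCast]
    simpa [PowerSeries.intCoeff, hypergeometricSeries, h0, h1, hA] using hzeq
  have hzd : ¬ (p : ℤ) ∣ (z.den : ℤ) := fun h => hz (Int.natCast_dvd_natCast.mp h)
  have hBd : ¬ (p : ℤ) ∣ (B.den : ℤ) := fun h => by
    have := Nat.le_of_dvd B.den_pos (Int.natCast_dvd_natCast.mp h)
    omega
  have hnum : ¬ (p : ℤ) ∣ (B - A n).num := fun h => by
    have := Nat.le_of_dvd (Int.natAbs_pos.mpr (Rat.num_ne_zero.mpr (sub_ne_zero.mpr (Ne.symm hne))))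
      (Int.natCast_dvd.mp h)
    omega
  have hsQ : (E : ℚ) - F = p * s := by exact_mod_cast hs
  have hmain : (B - A n) * F = p * (n * z * F - B * s) := by
    linear_combination -hEF + (F : ℚ) * hzeq' - B * hsQ
  have hint : ((B - A n).num : ℚ) * F * z.den * B.den =
      p * ((n * z.num * B.den * F - B.num * s * z.den) * (B - A n).den) := by
    have h1 : ((B - A n).num : ℚ) = (B - A n) * (B - A n).den := (Rat.mul_den_eq_num _).symm
    have h2 : (z.num : ℚ) = z * z.den := (Rat.mul_den_eq_num _).symm
    have h3 : (B.num : ℚ) = B * B.den := (Rat.mul_den_eq_num _).symm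
    rw [h1, h2, h3]
    linear_combination (z.den * B.den * (B - A n).den : ℚ) * hmain
  have hdvd : (p : ℤ) ∣ (B - A n).num * F * z.den * B.den :=
    ⟨(n * z.num * B.den * F - B.num * s * z.den) * (B - A n).den, by exact_mod_cast hint⟩
  rcases hpI.dvd_or_dvd hdvd with h | h
  · rcases hpI.dvd_or_dvd h with h | h
    · rcases hpI.dvd_or_dvd h with h | h
      · exact hnum h
      · exact hF h
    · exact hzd h
  · exact hBd h

end Converse

/-! ### Recovering parameters from the terms -/

theorem hypergeometricTerm_ne_zero {r s : ℕ} {α : Fin r → ℚ} {β : Fin s → ℚ}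
    (hα : ∀ i, ∀ m : ℕ, α i ≠ -(m : ℚ)) (hβ : ∀ j, ∀ m : ℕ, β j ≠ -(m : ℚ)) (n : ℕ) :
    hypergeometricTerm α β n ≠ 0 := div_ne_zero
  (Finset.prod_ne_zero_iff.mpr fun i _ => ascPochhammer_eval_ne_zero (hα i) n)
  (Finset.prod_ne_zero_iff.mpr fun j _ => ascPochhammer_eval_ne_zero (hβ j) n)

theorem hypergeometricTerm_succ {r s : ℕ} (α : Fin r → ℚ) (β : Fin s → ℚ) (n : ℕ) :
    hypergeometricTerm α β (n + 1) =
      hypergeometricTerm α β n * ((∏ i, (α i + n)) / ∏ j, (β j + n)) := by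
  unfold hypergeometricTerm
  simp only [ascPochhammer_succ_eval, Finset.prod_mul_distrib]
  rw [mul_div_mul_comm]

theorem prod_add_natCast_ne_zero {s : ℕ} {β : Fin s → ℚ} (hβ : ∀ j, ∀ m : ℕ, β j ≠ -(m : ℚ))
    (n : ℕ) : ∏ j, (β j + n) ≠ 0 :=
  Finset.prod_ne_zero_iff.mpr fun j _ h => hβ j n (eq_neg_of_add_eq_zero_left h)

/-- The terms of a hypergeometric series determine its parameters up to cancellation. -/
theorem multiset_eq_of_hypergeometricTerm_eq {r s r' s' : ℕ} {α : Fin r → ℚ} {β : Fin s → ℚ}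
    {α' : Fin r' → ℚ} {β' : Fin s' → ℚ}
    (hα : ∀ i, ∀ m : ℕ, α i ≠ -(m : ℚ)) (hβ : ∀ j, ∀ m : ℕ, β j ≠ -(m : ℚ))
    (hβ' : ∀ j, ∀ m : ℕ, β' j ≠ -(m : ℚ))
    (h : ∀ n, hypergeometricTerm α β n = hypergeometricTerm α' β' n) :
    Finset.univ.val.map α + Finset.univ.val.map β' =
      Finset.univ.val.map α' + Finset.univ.val.map β := by
  -- Ratios of consecutive terms are values at `n` of a rational function; cross-multiplied, the two
  -- polynomials agree at every natural number, and their roots are the negated parameters.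
  have hP : (((Finset.univ.val.map α + Finset.univ.val.map β').map fun x =>
        Polynomial.X - Polynomial.C (-x)).prod : Polynomial ℚ) =
      ((Finset.univ.val.map α' + Finset.univ.val.map β).map fun x =>
        Polynomial.X - Polynomial.C (-x)).prod := by
    apply Polynomial.eq_of_infinite_eval_eq
    refine (Set.infinite_range_of_injective (Nat.cast_injective (R := ℚ))).mono ?_
    rintro _ ⟨n, rfl⟩
    have h1 := h (n + 1)
    rw [hypergeometricTerm_succ, hypergeometricTerm_succ, ← h n] at h1
    have h2 := mul_left_cancel₀ (hypergeometricTerm_ne_zero hα hβ n) h1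
    rw [div_eq_div_iff (prod_add_natCast_ne_zero hβ n) (prod_add_natCast_ne_zero hβ' n)] at h2
    have hev : ∀ {k : ℕ} (γ : Fin k → ℚ), Polynomial.eval (n : ℚ) ((Finset.univ.val.map γ).map
        fun x => Polynomial.X - Polynomial.C (-x)).prod = ∏ i, (γ i + n) := by
      intro k γ
      rw [Multiset.map_map, Finset.prod_map_val, Polynomial.eval_prod]
      exact Finset.prod_congr rfl fun i _ => by simp [add_comm]
    rw [Set.mem_ofPred_eq, Multiset.map_add, Multiset.prod_add, Multiset.map_add, Multiset.prod_add,
      Polynomial.eval_mul, Polynomial.eval_mul, hev, hev, hev, hev, h2]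
  have hR := congrArg Polynomial.roots hP
  have hc : ∀ m : Multiset ℚ, (m.map fun x => Polynomial.X - Polynomial.C (-x)).prod.roots =
      m.map fun x => -x := by
    intro m
    rw [← Polynomial.roots_multiset_prod_X_sub_C (m.map fun x => -x), Multiset.map_map]
    rfl
  rw [hc, hc] at hR
  exact Multiset.map_injective neg_injective hR

/-! ### Unit-invariant multiplicities and factorials -/

section UnitInvariant

variable {d : ℕ} [NeZero d]

/-- Every residue is a unit times a divisor `g` of `d`, so `c` is determined by its values at
divisors; `l` is the Möbius inverse of `n ↦ c n`. -/
theorem exists_divisor_sum_of_unit_invariant (c : ZMod d → ℤ)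
    (hc : ∀ (u : (ZMod d)ˣ) (y : ZMod d), c (u * y) = c y) :
    ∃ l : ℕ → ℤ, ∀ y, c y = ∑ m ∈ d.divisors, if m ∣ y.posRep then l m else 0 := by
  refine ⟨fun n => ∑ x ∈ n.divisorsAntidiagonal, ArithmeticFunction.moebius x.1 •
    c ((x.2 : ℕ) : ZMod d), fun y => ?_⟩
  have hl := (ArithmeticFunction.sum_eq_iff_sum_smul_moebius_eq
    (f := fun n => ∑ x ∈ n.divisorsAntidiagonal, ArithmeticFunction.moebius x.1 •
      c ((x.2 : ℕ) : ZMod d)) (g := fun n => c (n : ZMod d))).mpr fun n _ => rfl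
  obtain ⟨g, hg, u, hu, hy⟩ := ZMod.eq_unit_mul_divisor y
  have hg0 : 0 < g := Nat.pos_of_dvd_of_pos hg (NeZero.pos d)
  obtain ⟨u, rfl⟩ := hu
  -- Modulo `m ∣ d`, the representative of `y` is still a unit times `g`.
  have hiff : ∀ m ∈ d.divisors, m ∣ y.posRep ↔ m ∣ g := by
    intro m hm
    have hmd := Nat.dvd_of_mem_divisors hm
    have h1 : (y.posRep : ZMod m) = ZMod.castHom hmd (ZMod m) u * (g : ZMod m) := by
      have := congrArg (ZMod.castHom hmd (ZMod m)) (y.natCast_posRep.trans hy)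
      rwa [map_natCast, map_mul, map_natCast] at this
    rw [← ZMod.natCast_eq_zero_iff, ← ZMod.natCast_eq_zero_iff, h1]
    exact (u.isUnit.map (ZMod.castHom hmd (ZMod m))).mul_right_eq_zero
  rw [hy, hc, ← hl g hg0, ← hy, ← Finset.sum_filter, Finset.filter_congr hiff]
  refine Finset.sum_congr ?_ fun _ _ => rfl
  ext m
  simp only [Finset.mem_filter, Nat.mem_divisors]
  exact ⟨fun h => ⟨⟨h.1.trans hg, NeZero.ne d⟩, h.1⟩, fun h => ⟨h.2, hg0.ne'⟩⟩

/-- Divided by `d`, the multiples `m * (k + 1)` become `(k + 1) / (d / m)`, the parameters of `((d /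
m) * n)!`. -/
theorem prod_posRep_of_dvd {M : Type*} [CommMonoid M] {m : ℕ} (hm : m ∣ d) (P : ℕ → M) :
    ∏ y : ZMod d with m ∣ y.posRep, P y.posRep = ∏ k : Fin (d / m), P (m * (k + 1)) := by
  have hm0 : 0 < m := Nat.pos_of_dvd_of_pos hm (NeZero.pos d)
  have hrep : ∀ k : Fin (d / m), ((m * (k + 1) : ℕ) : ZMod d).posRep = m * (k + 1) := fun k =>
    ZMod.posRep_natCast (by positivity) (by
      calc m * (k + 1) ≤ m * (d / m) := Nat.mul_le_mul_left m k.isLt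
        _ = d := Nat.mul_div_cancel' hm)
  symm
  refine Finset.prod_bij (fun k _ => ((m * (k + 1) : ℕ) : ZMod d)) ?_ ?_ ?_ ?_
  · intro k _
    rw [Finset.mem_filter, hrep]
    exact ⟨Finset.mem_univ _, dvd_mul_right _ _⟩
  · intro k _ k' _ h
    have h1 := congrArg ZMod.posRep h
    rw [hrep, hrep] at h1
    have := Nat.eq_of_mul_eq_mul_left hm0 h1
    exact Fin.ext (by omega)
  · intro y hy
    obtain ⟨j, hj⟩ := (Finset.mem_filter.mp hy).2
    have hj0 : 0 < j := Nat.pos_of_ne_zero (by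
      rintro rfl
      have := y.posRep_pos
      omega)
    have hjd : j ≤ d / m := by
      rw [Nat.le_div_iff_mul_le hm0, mul_comm, ← hj]
      exact y.posRep_le
    refine ⟨⟨j - 1, by omega⟩, Finset.mem_univ _, ?_⟩
    rw [Nat.sub_add_cancel hj0, ← hj, ZMod.natCast_posRep]
  · intro k _
    rw [hrep]

theorem isScaledFactorialRatio_of_unit_invariant (c : ZMod d → ℤ)
    (hc : ∀ (u : (ZMod d)ˣ) (y : ZMod d), c (u * y) = c y) :
    IsScaledFactorialRatio fun n =>
      ∏ y : ZMod d, ((ascPochhammer ℚ n).eval ((y.posRep : ℚ) / d)) ^ c y := by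
  obtain ⟨l, hl⟩ := exists_divisor_sum_of_unit_invariant c hc
  have hd : (d : ℚ) ≠ 0 := by exact_mod_cast NeZero.ne d
  have key : ∀ n, ∏ y : ZMod d, ((ascPochhammer ℚ n).eval ((y.posRep : ℚ) / d)) ^ c y =
      ∏ m ∈ d.divisors, (∏ k : Fin (d / m), (ascPochhammer ℚ n).eval
        (((k : ℕ) + 1 : ℚ) / (d / m : ℕ))) ^ l m := by
    intro n
    have h1 : ∀ y : ZMod d, ((ascPochhammer ℚ n).eval ((y.posRep : ℚ) / d)) ^ c y =
        ∏ m ∈ d.divisors, if m ∣ y.posRep then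
          ((ascPochhammer ℚ n).eval ((y.posRep : ℚ) / d)) ^ l m else 1 := by
      intro y
      have hne := ascPochhammer_eval_ne_zero y.posRep_div_ne_neg n
      rw [hl y]
      generalize (ascPochhammer ℚ n).eval ((y.posRep : ℚ) / d) = P at hne
      induction d.divisors using Finset.induction_on with
      | empty => simp
      | insert a s ha ih =>
        rw [Finset.sum_insert ha, Finset.prod_insert ha, zpow_add₀ hne, ih]
        congr 1
        split_ifs <;> simp
    rw [Finset.prod_congr rfl fun y _ => h1 y, Finset.prod_comm]
    refine Finset.prod_congr rfl fun m hm => ?_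
    have hmd := Nat.dvd_of_mem_divisors hm
    have hm0 : (m : ℚ) ≠ 0 := by
      exact_mod_cast (Nat.pos_of_dvd_of_pos hmd (NeZero.pos d)).ne'
    rw [← Finset.prod_filter, Finset.prod_zpow,
      prod_posRep_of_dvd hmd fun k => (ascPochhammer ℚ n).eval ((k : ℚ) / d)]
    congr 1
    refine Finset.prod_congr rfl fun k _ => ?_
    congr 1
    rw [Nat.cast_div hmd hm0]
    push_cast
    field_simp
  simp only [key]
  refine IsScaledFactorialRatio.prod _ fun m hm =>
    (IsScaledFactorialRatio.prod_ascPochhammer ?_).zpow _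
  exact Nat.div_pos (Nat.divisor_le hm) (Nat.pos_of_mem_divisors hm)

theorem isScaledFactorialRatio_of_hasGaussProperty {r : ℕ} {a b : Fin r → ℤ}
    (ha : ∀ i, ∀ m : ℕ, a i ≠ -(m * d)) (hb : ∀ j, ∀ m : ℕ, b j ≠ -(m * d))
    (hG : HasGaussProperty (hypergeometricSeries (fun i => (a i : ℚ) / d)
      (fun j => (b j : ℚ) / d)).intCoeff) :
    IsScaledFactorialRatio
      (hypergeometricTerm (fun i => (a i : ℚ) / d) (fun j => (b j : ℚ) / d)) := by
  have hdual := hypergeometricTerm_eq_of_hasGaussProperty ha hb hG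
  -- `N t x y` is the multiplicity of the residue `y` among the `t * x i`.
  let N (t : (ZMod d)ˣ) (x : Fin r → ℤ) (y : ZMod d) : ℕ :=
    (Finset.univ.filter fun i => t * (x i : ZMod d) = y).card
  have hcount : ∀ (t : (ZMod d)ˣ) (x : Fin r → ℤ) (y : ZMod d), Multiset.count ((y.posRep : ℚ) / d)
      (Finset.univ.val.map fun i => ((t * x i : ZMod d).posRep : ℚ) / d) = N t x y := by
    intro t x y
    rw [Multiset.count_map]
    have hd : (d : ℚ) ≠ 0 := by exact_mod_cast NeZero.ne d
    simp only [N, Finset.card_def, Finset.filter_val]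
    congr 1
    refine Multiset.filter_congr fun i _ => ?_
    rw [div_left_inj' hd, Nat.cast_inj, ZMod.posRep_injective.eq_iff, eq_comm]
  -- Only differences of multiplicities are determined, since common parameters cancel.
  have hN : ∀ t y, (N t a y : ℤ) - N t b y = N 1 a y - N 1 b y := by
    intro t y
    have h1 := multiset_eq_of_hypergeometricTerm_eq
      (fun i => ZMod.posRep_div_ne_neg (t * a i : ZMod d))
      (fun j => ZMod.posRep_div_ne_neg (t * b j : ZMod d))
      (fun j => ZMod.posRep_div_ne_neg ((1 : (ZMod d)ˣ) * b j : ZMod d))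
      (fun n => (hdual t n).symm.trans (hdual 1 n))
    have h2 := congrArg (Multiset.count ((y.posRep : ℚ) / d)) h1
    rw [Multiset.count_add, Multiset.count_add, hcount, hcount, hcount, hcount] at h2
    omega
  have hNu : ∀ (u : (ZMod d)ˣ) (x : Fin r → ℤ) (y : ZMod d), N 1 x (u * y) = N u⁻¹ x y := by
    intro u x y
    simp only [N]
    congr 1
    refine Finset.filter_congr fun i _ => ?_
    rw [Units.val_one, one_mul, Units.inv_mul_eq_iff_eq_mul]
  have hprod : ∀ (x : Fin r → ℤ) (n : ℕ), ∏ i, (ascPochhammer ℚ n).eval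
      (((((1 : (ZMod d)ˣ) : ZMod d) * x i : ZMod d).posRep : ℚ) / d) =
      ∏ y : ZMod d, ((ascPochhammer ℚ n).eval ((y.posRep : ℚ) / d)) ^ N 1 x y := by
    intro x n
    rw [← Finset.prod_fiberwise Finset.univ fun i => ((1 : (ZMod d)ˣ) : ZMod d) * x i]
    refine Finset.prod_congr rfl fun y _ => ?_
    rw [Finset.prod_congr rfl fun i hi => by rw [(Finset.mem_filter.mp hi).2], Finset.prod_const]
  have hfinal := isScaledFactorialRatio_of_unit_invariant
    (fun y => (N 1 a y : ℤ) - N 1 b y) fun u y => by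
      rw [hNu, hNu, hN]
  convert hfinal using 1
  ext n
  -- Even `t = 1` says something: it shifts all parameters by integers into `(0, 1]`.
  rw [hdual 1 n]
  unfold hypergeometricTerm
  rw [hprod, hprod, ← Finset.prod_div_distrib]
  refine Finset.prod_congr rfl fun y _ => ?_
  rw [zpow_sub₀ (ascPochhammer_eval_ne_zero y.posRep_div_ne_neg n), zpow_natCast, zpow_natCast]

end UnitInvariant

/-! ### Proof of the theorem -/

theorem satisfiesGaussCongruences_intCoeff {p : ℕ} {F : ℚ⟦X⟧}
    (h : ∀ n : ℕ, 0 < n → ∃ z ∈ localizedInt p,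
      PowerSeries.coeff (n * p) F - PowerSeries.coeff n F = n * p * z)
    (hp : p.Prime) : SatisfiesGaussCongruences p F.intCoeff := by
  intro n
  rcases lt_trichotomy n 0 with hn | hn | hn
  · refine ⟨0, by simpa [localizedInt] using hp.ne_one, ?_⟩
    have h1 : ¬ 0 ≤ n := by omega
    have h2 : ¬ 0 ≤ n * (p : ℤ) := by
      have : (0 : ℤ) < p := by exact_mod_cast hp.pos
      nlinarith
    simp [PowerSeries.intCoeff, h1, h2]
  · refine ⟨0, by simpa [localizedInt] using hp.ne_one, ?_⟩
    simp [hn]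
  · obtain ⟨k, rfl⟩ := Int.eq_ofNat_of_zero_le hn.le
    obtain ⟨z, hz, hk⟩ := h k (by exact_mod_cast hn)
    refine ⟨z, hz, ?_⟩
    have h1 : (0 : ℤ) ≤ k * p := by positivity
    have h2 : ((k : ℤ) * p).toNat = k * p := by rw [← Nat.cast_mul, Int.toNat_natCast]
    simpa [PowerSeries.intCoeff, h1, h2] using hk

theorem mainTheorem5 {r s : ℕ} (α : Fin r → ℚ) (β : Fin s → ℚ)
    (hα : ∀ i, ∀ m : ℕ, α i ≠ -(m : ℚ))
    (hβ : ∀ j, ∀ m : ℕ, β j ≠ -(m : ℚ))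
    (hF : (hypergeometricSeries α β).IsGloballyBounded) :
    (HasGaussProperty (hypergeometricSeries α β).intCoeff ↔
      (hypergeometricSeries α β).IsFactorial) ∧
    (∀ C : ℚ, C ≠ 0 → ∀ (u v : ℕ) (e : Fin u → ℕ) (f : Fin v → ℕ),
      (∀ i, 0 < e i) → (∀ j, 0 < f j) →
      PowerSeries.rescale C (hypergeometricSeries α β) = factorialRatioSeries e f →
      ∀ p : ℕ, p.Prime →
        SatisfiesGaussCongruences p (factorialRatioSeries e f).intCoeff) := by
  have hI : HasIntegralScaling (hypergeometricTerm α β) := by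
    simpa [hypergeometricSeries] using hF.hasIntegralScaling
  have hB : HasExponentialBound (hypergeometricTerm α β) := by
    simpa [hypergeometricSeries] using hF.hasExponentialBound
  have hratio : ∀ C : ℚ, C ≠ 0 → ∀ (u v : ℕ) (e : Fin u → ℕ) (f : Fin v → ℕ),
      (∀ i, 0 < e i) → (∀ j, 0 < f j) →
      PowerSeries.rescale C (hypergeometricSeries α β) = factorialRatioSeries e f →
      (∀ n, factorialRatio e f n = C ^ n * hypergeometricTerm α β n) ∧
      ∑ i, e i = ∑ j, f j ∧ ∀ n, ∃ z : ℤ, factorialRatio e f n = z := by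
    intro C hC u v e f he hf h
    have h1 : ∀ n, factorialRatio e f n = C ^ n * hypergeometricTerm α β n := by
      intro n
      have := congrArg (PowerSeries.coeff n) h
      simpa [PowerSeries.coeff_rescale, hypergeometricSeries, factorialRatioSeries] using this.symm
    have hI' := hI.of_rescale hC h1
    exact ⟨h1, sum_eq_of_factorialRatio he hf hI' (hB.of_rescale hC h1),
      factorialRatio_integral hI'⟩
  refine ⟨⟨fun hG => ?_, ?_⟩, ?_⟩
  · obtain rfl : r = s := by
      simpa using card_eq_of_integral_of_bound hα hβ hI hB
    obtain ⟨d₁, hd₁, h₁⟩ := exists_common_denominator α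
    obtain ⟨d₂, hd₂, h₂⟩ := exists_common_denominator β
    have hd := Nat.mul_pos hd₁ hd₂
    obtain ⟨d, rfl⟩ : ∃ d, d = d₁ * d₂ := ⟨_, rfl⟩
    have := NeZero.mk hd.ne'
    choose a ha using h₁ _ (dvd_mul_right d₁ d₂) hd
    choose b hb using h₂ _ (dvd_mul_left d₂ d₁) hd
    obtain rfl := funext ha
    obtain rfl := funext hb
    have hd' : ((d₁ * d₂ : ℕ) : ℚ) ≠ 0 := by exact_mod_cast hd.ne'
    have hne : ∀ (x : ℤ) (m : ℕ), (x : ℚ) / (d₁ * d₂ : ℕ) ≠ -(m : ℚ) →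
        x ≠ -(m * (d₁ * d₂ : ℕ)) := by
      intro x m hx h
      apply hx
      rw [div_eq_iff hd', h]
      push_cast
      ring
    obtain ⟨C, hC, u, v, e, f, he, hf, h⟩ := isScaledFactorialRatio_of_hasGaussProperty
      (fun i m => hne _ m (hα i m)) (fun j m => hne _ m (hβ j m)) hG
    refine ⟨C, hC, u, v, e, f, he, hf, ?_⟩
    ext n
    simpa [PowerSeries.coeff_rescale, hypergeometricSeries, factorialRatioSeries] using h n
  · rintro ⟨C, hC, u, v, e, f, he, hf, h⟩
    obtain ⟨h1, hsum, hint⟩ := hratio C hC u v e f he hf h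
    -- A prime above this bound divides neither the numerator nor the denominator of `C`.
    refine (Set.finite_Iic (C.num.natAbs + C.den)).subset ?_
    rintro p ⟨hp, hG⟩
    by_contra hlt
    rw [Set.mem_Iic, not_le] at hlt
    refine hG (satisfiesGaussCongruences_intCoeff (fun n hn => ?_) hp)
    have hterm : ∀ m, PowerSeries.coeff m (hypergeometricSeries α β) =
        (((C.den : ℤ) : ℚ) / C.num) ^ m * factorialRatio e f m := by
      intro m
      have hC' : ((C.den : ℤ) : ℚ) / C.num = C⁻¹ := by
        conv_rhs => rw [← Rat.num_div_den C]
        rw [inv_div, Int.cast_natCast]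
      rw [hC', h1, inv_pow, inv_mul_cancel_left₀ (pow_ne_zero m hC)]
      simp [hypergeometricSeries]
    rw [hterm, hterm]
    refine factorialRatio_gauss hp hsum hint (fun h => ?_) (fun h => ?_) hn
    · have := Nat.le_of_dvd C.den_pos (Int.natCast_dvd_natCast.mp h)
      omega
    · have := Nat.le_of_dvd (Int.natAbs_pos.mpr (Rat.num_ne_zero.mpr hC)) (Int.natCast_dvd.mp h)
      omega
  · intro C hC u v e f he hf h p hp
    obtain ⟨-, hsum, hint⟩ := hratio C hC u v e f he hf h
    refine satisfiesGaussCongruences_intCoeff (fun n hn => ?_) hp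
    have hp1 : ¬ (p : ℤ) ∣ 1 := fun h =>
      hp.one_lt.ne' (by exact_mod_cast Int.eq_one_of_dvd_one (by positivity) h)
    simpa [factorialRatioSeries] using factorialRatio_gauss hp hsum hint hp1 hp1 hn
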